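/- Let $(A_i)_{i\in I}$ be an inverse system, indexed by a countable directed preordered set $I$ (for example $I=\mathbb N$), of finitely generated abelian groups of constant rank $r$ all of whose transition maps $A_j\to A_i$ ($i\le j$) have finite cokernel, and let $\lim^1 A_i$ be its first derived limit. (1) If $\lim^1 A_i\neq 0$, then there are cardinals $n_q$ ($q$ prime) and an isomorphism $$\lim\nolimits^1 A_i\;\cong\;\mathbb Q^{(2^{\aleph_0})}\oplus\bigoplus_{q}(\mathbb Q_q/\mathbb Z_q)^{(n_q)},$$ where $q$ runs through all primes and an exponent $(n)$ denotes the direct sum of $n$ copies; and in every such decomposition $0\le n_q\le r$ for all primes $q$. (2) Let $p$ be a prime. If moreover the cokernels of all transition maps are finite $p$-groups, then either $\lim^1 A_i=0$, or a decomposition as in (1) exists and every such decomposition satisfies $n_p<n_l$ for every prime $l\neq p$ and $n_l=n_{l'}$ for all primes $l,l'\neq p$. -/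

import Mathlib

open scoped DirectSum

universe u v

section Lim1

variable {I : Type v} [Preorder I] {A : I → Type u} [∀ i, AddCommGroup (A i)]

/-- The differential `∏ i, A i → ∏ i ≤ j, A i` of the standard (Roos) complex that computes the
right derived functors of the limit: `(b i) ↦ (f i j (b j) - b i)`. -/
def roosD0 (f : ∀ ⦃i j : I⦄, i ≤ j → A j →+ A i) :
    (∀ i, A i) →+ (∀ x : {x : I × I // x.1 ≤ x.2}, A x.1.1) where
  toFun b x := f x.2 (b x.1.2) - b x.1.1
  map_zero' := by ext x; simp
  map_add' b c := by ext x; simp only [Pi.add_apply, map_add]; abel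

/-- The differential `∏ i ≤ j, A i → ∏ i ≤ j ≤ k, A i` of the Roos complex:
`(a i j) ↦ (f i j (a j k) - a i k + a i j)`. -/
def roosD1 (f : ∀ ⦃i j : I⦄, i ≤ j → A j →+ A i) :
    (∀ x : {x : I × I // x.1 ≤ x.2}, A x.1.1) →+
      (∀ x : {x : I × I × I // x.1 ≤ x.2.1 ∧ x.2.1 ≤ x.2.2}, A x.1.1) where
  toFun a x :=
    f x.2.1 (a ⟨(x.1.2.1, x.1.2.2), x.2.2⟩) - a ⟨(x.1.1, x.1.2.2), x.2.1.trans x.2.2⟩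
      + a ⟨(x.1.1, x.1.2.1), x.2.1⟩
  map_zero' := by ext x; simp
  map_add' a b := by ext x; simp only [Pi.add_apply, map_add]; abel

/-- The composite of the two differentials vanishes for an inverse system. -/
theorem roosD1_roosD0 (f : ∀ ⦃i j : I⦄, i ≤ j → A j →+ A i)
    (hf : InverseSystem (fun i j (h : i ≤ j) => (f h : A j → A i))) (b : ∀ i, A i) :
    roosD1 f (roosD0 f b) = 0 := by
  ext x
  have h := hf.map_map x.2.1 x.2.2 (b x.1.2.2)
  simp only [roosD1, roosD0, AddMonoidHom.coe_mk, ZeroHom.coe_mk, map_sub, Pi.zero_apply]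
  rw [h]
  abel

/-- The first derived limit `lim¹ A i` of an inverse system of abelian groups, as the first
cohomology group (cocycles modulo coboundaries) of the Roos complex. -/
def Lim1 (f : ∀ ⦃i j : I⦄, i ≤ j → A j →+ A i) : Type max u v :=
  (roosD1 f).ker ⧸ (roosD0 f).range.addSubgroupOf (roosD1 f).ker

instance (f : ∀ ⦃i j : I⦄, i ≤ j → A j →+ A i) : AddCommGroup (Lim1 f) :=
  inferInstanceAs
    (AddCommGroup ((roosD1 f).ker ⧸ (roosD0 f).range.addSubgroupOf (roosD1 f).ker))

end Lim1

/-- The group `ℚ_p / ℤ_p`. -/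
abbrev PadicQuot (p : Nat.Primes) : Type :=
  haveI : Fact (p : ℕ).Prime := ⟨p.2⟩
  ℚ_[(p : ℕ)] ⧸ (PadicInt.subring (p : ℕ)).toAddSubgroup

/-- `G ≅ ℚ^(n₀) ⊕ ⨁ p, (ℚ_p / ℤ_p)^(n p)`, where `n₀ = 2 ^ ℵ₀` and `n p` are cardinal numbers,
and the exponents denote direct sums of that many copies. -/
def HasJensenDecomposition (G : Type*) [AddCommGroup G] (n : Nat.Primes → Cardinal.{0}) : Prop :=
  Nonempty (G ≃+
    (Cardinal.continuum.{0}.out →₀ ℚ) × (⨁ p : Nat.Primes, ((n p).out →₀ PadicQuot p)))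

/-!
Write `lim¹` for `Lim1 f`. A cofinal increasing sequence in `I` reduces the problem to a tower
indexed by `ℕ`, where `lim¹` is the cokernel of `(b n) ↦ (b n - f (b (n + 1)))`
(`nonempty_lim1_equiv_towerLim1`). By Kőnig's lemma `lim¹` of a tower of finite groups vanishes
(`towerDiff_surjective_of_finite`), so that kernels of finite order can be divided out. Because all
ranks agree, this replaces the tower by a decreasing sequence `L n` of subgroups of finite index in
a free group `G` of rank `r` (`exists_subgroup_tower`); let `D` be its `lim¹`.

* `D` is divisible, because `lim¹` of the finite groups `L n / m L n` vanishes
  (`towerLim1_divisible`).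
* For a prime `q` there is an exact sequence
  `0 → M / q M → lim (L n / q L n) → D[q] → 0` with `M = ⋂ n, L n`. In terms of orders this is
  `card_nTorsion_towerLim1`. The limit has order at most `q ^ r`, since it embeds into `L n / q L n`
  for large `n` (`exists_compatMod_stable`), and hence `D[q]` has order `q ^ k` with
  `k ≤ r - rank M`.
* If all `L n / L m` are `p`-groups, then the limit has order exactly `l ^ r` for each prime `l ≠ p`
  (`limModCard_eq_of_ne`). If its order is maximal for `p` as well, then `L n = L (n + 1) + p L n`
  for large `n`, the sequence is eventually constant and `D = 0` (`exists_stable_of_limModCard_eq`).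
* If the sequence is not eventually constant, then `D` has cardinality `2 ^ ℵ₀` (`mk_towerLim1`).

A divisible group is the direct sum of its torsion and a `ℚ`-vector space, and the torsion is a sum
of copies of `ℚ_q / ℤ_q`, as many as the dimension of the `q`-torsion over `ℤ / q`
(`exists_torsionFree_complement`, `hasJensenDecomposition_of_card`). Conversely the orders of the
`D[q]` determine the exponents of every decomposition (`HasJensenDecomposition.exponent_eq`).
-/

/-! ### Towers of abelian groups -/

section Tower

variable {A : ℕ → Type u} [∀ n, AddCommGroup (A n)]

/-- The endomorphism `(b n) ↦ (b n - f n (b (n + 1)))` of `∏ n, A n` attached to a tower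
`⋯ → A 2 → A 1 → A 0`. -/
def towerDiff (f : ∀ n, A (n + 1) →+ A n) : (∀ n, A n) →+ (∀ n, A n) where
  toFun b n := b n - f n (b (n + 1))
  map_zero' := by ext n; simp
  map_add' b c := by ext n; simp only [Pi.add_apply, map_add]; abel

@[simp]
theorem towerDiff_apply (f : ∀ n, A (n + 1) →+ A n) (b : ∀ n, A n) (n : ℕ) :
    towerDiff f b n = b n - f n (b (n + 1)) := rfl

/-- The first derived limit of a tower of abelian groups, as the cokernel of `towerDiff`. -/
abbrev TowerLim1 (f : ∀ n, A (n + 1) →+ A n) : Type u := (∀ n, A n) ⧸ (towerDiff f).range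

end Tower

/-- Kőnig's lemma for a tower of finite nonempty sets, whose maps need not respect any structure. -/
theorem exists_tower_section {X : ℕ → Type u} [∀ n, Finite (X n)] [∀ n, Nonempty (X n)]
    (g : ∀ n, X (n + 1) → X n) : ∃ b : ∀ n, X n, ∀ n, b n = g n (b (n + 1)) := by
  let F := CategoryTheory.Functor.ofOpSequence (fun n => TypeCat.ofHom (g n))
  have : ∀ j, Finite (F.obj j) := fun j => inferInstanceAs (Finite (X j.unop))
  have : ∀ j, Nonempty (F.obj j) := fun j => inferInstanceAs (Nonempty (X j.unop))
  obtain ⟨b, hb⟩ := nonempty_sections_of_finite_inverse_system F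
  refine ⟨fun n => b (Opposite.op n), fun n => ?_⟩
  have h := hb (CategoryTheory.homOfLE n.le_succ).op
  rw [CategoryTheory.Functor.ofOpSequence_map_homOfLE_succ] at h
  exact h.symm

/-- `lim¹` of a tower of finite groups vanishes: solving `b n = x n + f n (b (n + 1))` amounts to
finding a section of a tower of finite sets with affine transition maps. -/
theorem towerDiff_surjective_of_finite {A : ℕ → Type u} [∀ n, AddCommGroup (A n)]
    [∀ n, Finite (A n)] (f : ∀ n, A (n + 1) →+ A n) : Function.Surjective (towerDiff f) := by
  intro x
  obtain ⟨b, hb⟩ := exists_tower_section (fun n (y : A (n + 1)) => x n + f n y)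
  refine ⟨b, funext fun n => ?_⟩
  rw [towerDiff_apply, sub_eq_iff_eq_add]
  exact hb n

/-- A levelwise surjective map of towers with finite kernels induces an isomorphism on `lim¹`. -/
theorem nonempty_towerLim1_equiv {A B : ℕ → Type u} [∀ n, AddCommGroup (A n)]
    [∀ n, AddCommGroup (B n)] (f : ∀ n, A (n + 1) →+ A n) (g : ∀ n, B (n + 1) →+ B n)
    (π : ∀ n, A n →+ B n) (hπ : ∀ n x, π n (f n x) = g n (π (n + 1) x))
    (hs : ∀ n, Function.Surjective (π n)) (hk : ∀ n, Finite (π n).ker) :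
    Nonempty (TowerLim1 f ≃+ TowerLim1 g) := by
  let ϖ : (∀ n, A n) →+ (∀ n, B n) := AddMonoidHom.pi fun n => (π n).comp (Pi.evalAddMonoidHom A n)
  have hϖ : ∀ a n, ϖ a n = π n (a n) := fun a n => rfl
  have hcomm : ∀ b, ϖ (towerDiff f b) = towerDiff g (ϖ b) := by
    intro b
    ext n
    simp only [hϖ, towerDiff_apply, map_sub, hπ]
  have hsurj : ∀ b, ∃ a, ϖ a = b := fun b =>
    ⟨fun n => (hs n (b n)).choose, funext fun n => (hs n (b n)).choose_spec⟩
  let Φ : (∀ n, A n) →+ TowerLim1 g := (QuotientAddGroup.mk' _).comp ϖ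
  have hΦ : Function.Surjective Φ := (QuotientAddGroup.mk'_surjective _).comp hsurj
  have hker : (towerDiff f).range = Φ.ker := by
    ext a
    rw [AddMonoidHom.mem_ker]
    change _ ↔ ((ϖ a : ∀ n, B n) : TowerLim1 g) = 0
    rw [QuotientAddGroup.eq_zero_iff]
    constructor
    · rintro ⟨b, rfl⟩
      exact ⟨ϖ b, (hcomm b).symm⟩
    · rintro ⟨c, hc⟩
      obtain ⟨b, rfl⟩ := hsurj c
      have hmem : ∀ n, a n - towerDiff f b n ∈ (π n).ker := by
        intro n
        rw [AddMonoidHom.mem_ker, map_sub, ← hϖ a, ← hϖ (towerDiff f b), hcomm, hc, sub_self]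
      let fk : ∀ n, (π (n + 1)).ker →+ (π n).ker := fun n =>
        ((f n).comp (π (n + 1)).ker.subtype).codRestrict _ (by
          rintro ⟨x, hx⟩
          rw [AddMonoidHom.mem_ker] at hx ⊢
          simp [hπ, hx])
      obtain ⟨k, hk⟩ := towerDiff_surjective_of_finite (A := fun n => (π n).ker) fk
        (fun n => ⟨_, hmem n⟩)
      refine ⟨b + fun n => (k n : A n), ?_⟩
      rw [map_add]
      ext n
      have h := congrArg Subtype.val (congrFun hk n)
      have h' : (k n : A n) - f n (k (n + 1)) = a n - towerDiff f b n := h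
      rw [Pi.add_apply, towerDiff_apply f (fun n => (k n : A n)), h', add_sub_cancel]
  exact ⟨(QuotientAddGroup.quotientAddEquivOfEq hker).trans
    (QuotientAddGroup.quotientKerEquivOfSurjective Φ hΦ)⟩

/-! ### Reduction of a countable directed system to a tower -/

/-- A function on an upward closed set of natural numbers that does not change in single steps is
constant. -/
theorem eq_of_forall_succ_eq {X : Type*} {P : ℕ → Prop} (hP : ∀ n, P n → P (n + 1))
    (τ : ∀ n, P n → X) (h : ∀ n hn, τ (n + 1) (hP n hn) = τ n hn) {n m : ℕ} (hn : P n)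
    (hm : P m) : τ n hn = τ m hm := by
  have key : ∀ k n (hn : P n), ∃ hk : P (n + k), τ (n + k) hk = τ n hn := by
    intro k n hn
    induction k with
    | zero => exact ⟨hn, rfl⟩
    | succ k ih =>
      obtain ⟨hk, e⟩ := ih
      exact ⟨hP _ hk, (h _ hk).trans e⟩
  rcases le_total n m with hnm | hnm
  · obtain ⟨k, rfl⟩ := Nat.exists_eq_add_of_le hnm
    exact ((key k n hn).choose_spec).symm
  · obtain ⟨k, rfl⟩ := Nat.exists_eq_add_of_le hnm
    exact (key k m hm).choose_spec

section Cofinal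

variable {I : Type v} [Preorder I] {A : I → Type u} [∀ i, AddCommGroup (A i)]
  (f : ∀ ⦃i j : I⦄, i ≤ j → A j →+ A i)
  (hf : InverseSystem (fun i j (h : i ≤ j) => (f h : A j → A i)))
  {s : ℕ → I} (hs : Monotone s) (hcof : ∀ i, ∃ n, i ≤ s n)

theorem mem_ker_roosD1_iff (a : ∀ x : {x : I × I // x.1 ≤ x.2}, A x.1.1) :
    a ∈ (roosD1 f).ker ↔ ∀ (i j k : I) (h : i ≤ j) (h' : j ≤ k),
      f h (a ⟨(j, k), h'⟩) - a ⟨(i, k), h.trans h'⟩ + a ⟨(i, j), h⟩ = 0 := by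
  rw [AddMonoidHom.mem_ker]
  constructor
  · intro ha i j k h h'
    exact congrFun ha ⟨(i, j, k), h, h'⟩
  · intro ha
    ext x
    exact ha _ _ _ x.2.1 x.2.2

include hf hs hcof in
/-- A Roos cocycle is a coboundary as soon as its restriction to the consecutive pairs of a cofinal
sequence is one. -/
theorem exists_roosD0_eq {a : ∀ x : {x : I × I // x.1 ≤ x.2}, A x.1.1}
    (ha : a ∈ (roosD1 f).ker) (b : ∀ n, A (s n))
    (hb : ∀ n, a ⟨(s n, s (n + 1)), hs n.le_succ⟩ = b n - f (hs n.le_succ) (b (n + 1))) :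
    ∃ c, roosD0 f c = a := by
  rw [mem_ker_roosD1_iff] at ha
  have hff : ∀ {i j k : I} (h : i ≤ j) (h' : j ≤ k) x, f h (f h' x) = f (h.trans h') x :=
    fun h h' x => hf.map_map h h' x
  have hinv : ∀ i {n m : ℕ} (hn : i ≤ s n) (hm : i ≤ s m),
      -f hn (b n) - a ⟨(i, s n), hn⟩ = -f hm (b m) - a ⟨(i, s m), hm⟩ := by
    intro i n m hn hm
    refine eq_of_forall_succ_eq (P := fun n => i ≤ s n) (fun n h => h.trans (hs n.le_succ))
      (fun n hn => -f hn (b n) - a ⟨(i, s n), hn⟩) (fun n hn => ?_) hn hm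
    have h := ha i (s n) (s (n + 1)) hn (hs n.le_succ)
    rw [hb, map_sub, hff] at h
    rw [← sub_eq_zero, ← h]
    abel
  choose N hN using hcof
  refine ⟨fun i => -f (hN i) (b (N i)) - a ⟨(i, s (N i)), hN i⟩, funext ?_⟩
  rintro ⟨⟨i, j⟩, hij⟩
  change i ≤ j at hij
  change f hij (-f (hN j) (b (N j)) - a ⟨(j, s (N j)), hN j⟩) -
    (-f (hN i) (b (N i)) - a ⟨(i, s (N i)), hN i⟩) = a ⟨(i, j), hij⟩
  rw [hinv i (hN i) (hij.trans (hN j)), map_sub, map_neg, hff]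
  have h := ha i j (s (N j)) hij (hN j)
  rw [← sub_eq_zero, ← neg_eq_zero, ← h]
  abel

include hf hs hcof in
/-- Every family on the consecutive pairs of a cofinal sequence is, up to a coboundary, the
restriction of a Roos cocycle. -/
theorem exists_roos_cocycle (x : ∀ n, A (s n)) :
    ∃ a ∈ (roosD1 f).ker, ∃ e : ∀ n, A (s n), ∀ n,
      a ⟨(s n, s (n + 1)), hs n.le_succ⟩ = x n + (e n - f (hs n.le_succ) (e (n + 1))) := by
  classical
  have hff : ∀ {i j k : I} (h : i ≤ j) (h' : j ≤ k) x, f h (f h' x) = f (h.trans h') x :=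
    fun h h' x => hf.map_map h h' x
  -- Truncations of the formal solution `∑ k, f (x k)`; the cocycle is the coboundary of this
  -- divergent sum, in which all but finitely many terms cancel.
  let σ : ∀ i, ℕ → A i := fun i N =>
    ∑ k ∈ Finset.range N, if h : i ≤ s k then f h (x k) else 0
  have hσ : ∀ i n (h : i ≤ s n), σ i (n + 1) = σ i n + f h (x n) := by
    intro i n h
    simp only [σ, Finset.sum_range_succ, dif_pos h]
  have hinv : ∀ {i j} (hij : i ≤ j) {n m : ℕ} (_ : j ≤ s n) (_ : j ≤ s m),
      σ i n - f hij (σ j n) = σ i m - f hij (σ j m) := by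
    intro i j hij n m hn hm
    refine eq_of_forall_succ_eq (P := fun n => j ≤ s n) (fun n h => h.trans (hs n.le_succ))
      (fun n _ => σ i n - f hij (σ j n)) (fun n hn => ?_) hn hm
    simp only [hσ j n hn, hσ i n (hij.trans hn), map_add, hff]
    abel
  choose N hN using hcof
  refine ⟨fun y => σ y.1.1 (N y.1.2) - f y.2 (σ y.1.2 (N y.1.2)), ?_, fun n => σ (s n) n, ?_⟩
  · rw [mem_ker_roosD1_iff]
    intro i j k h h'
    dsimp only
    rw [hinv h (hN j) (h'.trans (hN k)), map_sub, hff]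
    abel
  · intro n
    dsimp only
    rw [hinv (hs n.le_succ) (hN _) (le_refl (s (n + 1))), hσ (s n) n le_rfl]
    have hid : f (le_refl (s n)) (x n) = x n := hf.map_self (i := s n) (x n)
    rw [hid]
    abel

include hf hcof in
/-- The derived limit of an inverse system is computed by any cofinal increasing sequence. -/
theorem nonempty_lim1_equiv_towerLim1 :
    Nonempty (Lim1 f ≃+ TowerLim1 (A := fun n => A (s n)) (fun n => f (hs n.le_succ))) := by
  let R : (roosD1 f).ker →+ (∀ n, A (s n)) :=
    { toFun := fun a n => a.1 ⟨(s n, s (n + 1)), hs n.le_succ⟩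
      map_zero' := rfl
      map_add' := fun _ _ => rfl }
  let Φ : (roosD1 f).ker →+ TowerLim1 (A := fun n => A (s n)) (fun n => f (hs n.le_succ)) :=
    (QuotientAddGroup.mk' _).comp R
  have hΦ : Function.Surjective Φ := by
    intro y
    obtain ⟨x, rfl⟩ := QuotientAddGroup.mk_surjective y
    obtain ⟨a, ha, e, h⟩ := exists_roos_cocycle f hf hs hcof x
    refine ⟨⟨a, ha⟩, ?_⟩
    refine QuotientAddGroup.eq.2 ⟨-e, funext fun n => ?_⟩
    change -e n - f _ (-e (n + 1)) = -a ⟨(s n, s (n + 1)), hs n.le_succ⟩ + x n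
    rw [h, map_neg]
    abel
  have hker : (roosD0 f).range.addSubgroupOf (roosD1 f).ker = Φ.ker := by
    ext ⟨a, ha⟩
    rw [AddSubgroup.mem_addSubgroupOf, AddMonoidHom.mem_ker]
    change _ ↔ ((R ⟨a, ha⟩ : ∀ n, A (s n)) :
      TowerLim1 (A := fun n => A (s n)) (fun n => f (hs n.le_succ))) = 0
    rw [QuotientAddGroup.eq_zero_iff]
    constructor
    · rintro ⟨c, rfl⟩
      refine ⟨fun n => -c (s n), funext fun n => ?_⟩
      change -c (s n) - f _ (-c (s (n + 1))) = f _ (c (s (n + 1))) - c (s n)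
      rw [map_neg]
      abel
    · rintro ⟨b, hb⟩
      exact exists_roosD0_eq f hf hs hcof ha b fun n => (congrFun hb n).symm
  exact ⟨(QuotientAddGroup.quotientAddEquivOfEq hker).trans
    (QuotientAddGroup.quotientKerEquivOfSurjective Φ hΦ)⟩

end Cofinal

/-! ### Torsion in direct sums and in the groups `ℚ_p / ℤ_p` -/

/-- The subgroup of elements killed by `n`. -/
abbrev nTorsion (D : Type*) [AddCommGroup D] (n : ℕ) : AddSubgroup D :=
  (nsmulAddMonoidHom (α := D) n).ker

theorem mem_nTorsion {D : Type*} [AddCommGroup D] {n : ℕ} {x : D} :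
    x ∈ nTorsion D n ↔ n • x = 0 := Iff.rfl

theorem eq_zero_of_nsmul_pow_eq_zero {D : Type*} [AddCommGroup D] {q l : ℕ}
    (h : Nat.Coprime q l) {x : D} (hq : q • x = 0) {k : ℕ} (hl : l ^ k • x = 0) : x = 0 := by
  have h1 : addOrderOf x ∣ q := addOrderOf_dvd_of_nsmul_eq_zero hq
  have h2 : addOrderOf x ∣ l ^ k := addOrderOf_dvd_of_nsmul_eq_zero hl
  have h3 := Nat.dvd_gcd h1 h2
  rw [(h.pow_right k : Nat.gcd q (l ^ k) = 1), Nat.dvd_one] at h3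
  exact AddMonoid.addOrderOf_eq_one_iff.1 h3

/-- In a group without elements of prime order, multiplication by a positive integer is
injective. -/
theorem eq_zero_of_nsmul_eq_zero {D : Type*} [AddCommGroup D]
    (h : ∀ q : ℕ, q.Prime → ∀ x : D, q • x = 0 → x = 0) (n : ℕ) (hn : n ≠ 0) (x : D)
    (hx : n • x = 0) : x = 0 := by
  induction n using Nat.recOnMul generalizing x with
  | zero => exact absurd rfl hn
  | one => simpa using hx
  | prime q hq => exact h q hq x hx
  | mul a b ha hb =>
    rw [mul_smul] at hx
    exact hb (right_ne_zero_of_mul hn) _ (ha (left_ne_zero_of_mul hn) _ hx)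

section PrimaryDirectSum

variable {S : Nat.Primes → Type*} [∀ q, AddCommGroup (S q)]
  (hS : ∀ (q : Nat.Primes) (x : S q), ∃ k, (q : ℕ) ^ k • x = 0)

include hS in
/-- In a direct sum of `q`-primary groups, an element killed by `q` lies in the `q`-th summand. -/
theorem directSum_eq_of_of_nsmul_eq_zero (q : Nat.Primes) (x : ⨁ q, S q) (hx : (q : ℕ) • x = 0) :
    (q : ℕ) • x q = 0 ∧ x = DirectSum.of S q (x q) := by
  have hcomp : ∀ l, (q : ℕ) • x l = 0 := fun l => by
    have h := congrArg (DFinsupp.evalAddMonoidHom (β := S) l) hx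
    rw [map_zero] at h
    exact (map_nsmul (DFinsupp.evalAddMonoidHom (β := S) l) _ x).symm.trans h
  refine ⟨hcomp q, ?_⟩
  ext l
  by_cases hl : l = q
  · subst hl
    rw [DirectSum.of_eq_same]
  · rw [DirectSum.of_eq_of_ne _ _ _ hl]
    obtain ⟨k, hk⟩ := hS l (x l)
    refine eq_zero_of_nsmul_pow_eq_zero ?_ (hcomp l) hk
    exact (Nat.coprime_primes q.2 l.2).2 fun h => hl (Nat.Primes.coe_nat_injective h.symm)

include hS in
theorem exists_ne_zero_nsmul_prime_eq_zero (x : ⨁ q, S q) (hx : x ≠ 0) :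
    ∃ n : ℕ, ∃ q : Nat.Primes, n • x ≠ 0 ∧ (q : ℕ) • n • x = 0 := by
  classical
  have htor : ∃ m : ℕ, m ≠ 0 ∧ m • x = 0 := by
    induction x using DirectSum.induction_on with
    | zero => exact ⟨1, one_ne_zero, smul_zero _⟩
    | of q y =>
      obtain ⟨k, hk⟩ := hS q y
      exact ⟨_, pow_ne_zero k q.2.ne_zero, by rw [← map_nsmul, hk, map_zero]⟩
    | add y z hy hz =>
      by_cases hy0 : y = 0
      · subst hy0
        rw [zero_add] at hx ⊢
        exact hz hx
      by_cases hz0 : z = 0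
      · subst hz0
        rw [add_zero] at hx ⊢
        exact hy hx
      obtain ⟨a, ha, hay⟩ := hy hy0
      obtain ⟨b, hb, hbz⟩ := hz hz0
      refine ⟨a * b, mul_ne_zero ha hb, ?_⟩
      rw [smul_add, mul_comm, mul_smul, hay, mul_comm, mul_smul, hbz, smul_zero, smul_zero, add_zero]
  have hmin := Nat.find_spec htor
  have hne1 : Nat.find htor ≠ 1 := fun h => by
    rw [h, one_smul] at hmin
    exact hx hmin.2
  obtain ⟨q, hq, n, hn⟩ := Nat.exists_prime_and_dvd hne1
  have hn0 : n ≠ 0 := fun h => hmin.1 (by rw [hn, h, mul_zero])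
  refine ⟨n, ⟨q, hq⟩, fun h => ?_, ?_⟩
  · refine Nat.find_min htor (m := n) ?_ ⟨hn0, h⟩
    rw [hn]
    exact lt_mul_of_one_lt_left (Nat.pos_of_ne_zero hn0) hq.one_lt
  · change q • n • x = 0
    rw [← mul_smul, ← hn]
    exact hmin.2

end PrimaryDirectSum

section PadicQuot

variable (q : Nat.Primes)

instance : Countable (PadicQuot q) := by
  have : Fact (q : ℕ).Prime := ⟨q.2⟩
  refine Function.Surjective.countable
    (f := fun r : ℚ => ((r : ℚ_[(q : ℕ)]) : PadicQuot q)) fun x => ?_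
  obtain ⟨x, rfl⟩ := QuotientAddGroup.mk_surjective x
  obtain ⟨r, hr⟩ := Padic.rat_dense (q : ℕ) x zero_lt_one
  refine ⟨r, QuotientAddGroup.eq.2 ?_⟩
  change ‖-(r : ℚ_[(q : ℕ)]) + x‖ ≤ 1
  rw [neg_add_eq_sub]
  exact hr.le

theorem padicQuot_divisible (n : ℕ) (hn : n ≠ 0) (x : PadicQuot q) : ∃ y, n • y = x := by
  have : Fact (q : ℕ).Prime := ⟨q.2⟩
  obtain ⟨x, rfl⟩ := QuotientAddGroup.mk_surjective x
  refine ⟨((x / n : ℚ_[(q : ℕ)]) : PadicQuot q), ?_⟩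
  rw [← QuotientAddGroup.mk_nsmul, nsmul_eq_mul, mul_div_cancel₀]
  exact Nat.cast_ne_zero.2 hn

theorem padicQuot_primary (x : PadicQuot q) : ∃ k, (q : ℕ) ^ k • x = 0 := by
  have : Fact (q : ℕ).Prime := ⟨q.2⟩
  obtain ⟨x, rfl⟩ := QuotientAddGroup.mk_surjective x
  obtain ⟨k, hk⟩ := pow_unbounded_of_one_lt ‖x‖ (Nat.one_lt_cast.2 q.2.one_lt : (1 : ℝ) < (q : ℕ))
  refine ⟨k, ?_⟩
  rw [← QuotientAddGroup.mk_nsmul, QuotientAddGroup.eq_zero_iff]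
  change ‖(q : ℕ) ^ k • x‖ ≤ 1
  have hq0 : (0 : ℝ) < ((q : ℕ) : ℝ) ^ k := pow_pos (Nat.cast_pos.2 q.2.pos) k
  rw [nsmul_eq_mul, Nat.cast_pow, norm_mul, norm_pow, Padic.norm_p, inv_pow, inv_mul_le_iff₀ hq0,
    mul_one]
  exact hk.le

/-- The `q`-torsion of `ℚ_q / ℤ_q` consists of the classes of `m / q` for `0 ≤ m < q`. -/
theorem card_nTorsion_padicQuot : Nat.card (nTorsion (PadicQuot q) q) = q := by
  have : Fact (q : ℕ).Prime := ⟨q.2⟩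
  have hq0 : ((q : ℕ) : ℚ_[(q : ℕ)]) ≠ 0 := Nat.cast_ne_zero.2 q.2.ne_zero
  have hqr : (0 : ℝ) < (q : ℕ) := Nat.cast_pos.2 q.2.pos
  let φ : Fin q → nTorsion (PadicQuot q) q := fun m =>
    ⟨(((m : ℕ) / (q : ℕ) : ℚ_[(q : ℕ)]) : PadicQuot q), by
      rw [mem_nTorsion, ← QuotientAddGroup.mk_nsmul, nsmul_eq_mul, mul_div_cancel₀ _ hq0,
        QuotientAddGroup.eq_zero_iff]
      exact natCast_mem (PadicInt.subring (q : ℕ)) _⟩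
  have hφ : Function.Bijective φ := by
    constructor
    · intro a b hab
      have h := QuotientAddGroup.eq.1 (congrArg Subtype.val hab)
      change ‖-((a : ℕ) / (q : ℕ) : ℚ_[(q : ℕ)]) + (b : ℕ) / (q : ℕ)‖ ≤ 1 at h
      rw [neg_add_eq_sub, ← sub_div, norm_div, Padic.norm_p, div_inv_eq_mul,
        ← le_div_iff₀ hqr, one_div] at h
      have h1 : ‖(((b : ℕ) - (a : ℕ) : ℤ) : ℚ_[(q : ℕ)])‖ < 1 := by
        push_cast
        exact h.trans_lt (inv_lt_one_of_one_lt₀ (Nat.one_lt_cast.2 q.2.one_lt))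
      rw [Padic.norm_intCast_lt_one_iff] at h1
      have h2 : (b : ℕ) ≡ a [MOD q] := ((Nat.modEq_iff_dvd.2 h1)).symm
      exact Fin.ext (Nat.ModEq.eq_of_lt_of_lt h2 b.2 a.2).symm
    · rintro ⟨x, hx⟩
      obtain ⟨x, rfl⟩ := QuotientAddGroup.mk_surjective x
      rw [mem_nTorsion, ← QuotientAddGroup.mk_nsmul, nsmul_eq_mul,
        QuotientAddGroup.eq_zero_iff] at hx
      obtain ⟨n, hn, hnx⟩ := PadicInt.exists_mem_range (p := (q : ℕ)) ⟨_, hx⟩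
      refine ⟨⟨n, hn⟩, Subtype.ext (QuotientAddGroup.eq.2 ?_)⟩
      rw [PadicInt.maximalIdeal_eq_span_p, Ideal.mem_span_singleton] at hnx
      obtain ⟨c, hc⟩ := hnx
      have hc' : (q : ℕ) * x - n = (q : ℕ) * (c : ℚ_[(q : ℕ)]) := congrArg Subtype.val hc
      have : -((n : ℕ) / (q : ℕ) : ℚ_[(q : ℕ)]) + x = c := by
        field_simp
        linear_combination hc'
      change -((n : ℕ) / (q : ℕ) : ℚ_[(q : ℕ)]) + x ∈ _
      rw [this]
      exact c.2
  rw [← Nat.card_congr (Equiv.ofBijective φ hφ), Nat.card_fin]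

variable (α : Type u)

theorem finsupp_padicQuot_divisible (n : ℕ) (hn : n ≠ 0) (x : α →₀ PadicQuot q) :
    ∃ y, n • y = x := by
  induction x using Finsupp.induction_linear with
  | zero => exact ⟨0, smul_zero _⟩
  | add x y hx hy =>
    obtain ⟨a, rfl⟩ := hx
    obtain ⟨b, rfl⟩ := hy
    exact ⟨a + b, smul_add _ _ _⟩
  | single i x =>
    obtain ⟨y, rfl⟩ := padicQuot_divisible q n hn x
    exact ⟨Finsupp.single i y, Finsupp.smul_single _ _ _⟩

theorem finsupp_padicQuot_primary (x : α →₀ PadicQuot q) : ∃ k, (q : ℕ) ^ k • x = 0 := by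
  induction x using Finsupp.induction_linear with
  | zero => exact ⟨0, smul_zero _⟩
  | add x y hx hy =>
    obtain ⟨a, ha⟩ := hx
    obtain ⟨b, hb⟩ := hy
    refine ⟨a + b, ?_⟩
    rw [smul_add, pow_add, mul_smul _ _ y, hb, mul_comm, mul_smul, ha, smul_zero, smul_zero,
      add_zero]
  | single i x =>
    obtain ⟨k, hk⟩ := padicQuot_primary q x
    exact ⟨k, by rw [Finsupp.smul_single, hk, Finsupp.single_zero]⟩

theorem card_nTorsion_finsupp_padicQuot [Finite α] :
    Nat.card (nTorsion (α →₀ PadicQuot q) q) = (q : ℕ) ^ Nat.card α := by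
  have e : nTorsion (α →₀ PadicQuot q) q ≃ (α → nTorsion (PadicQuot q) q) :=
    { toFun := fun x i => ⟨x.1 i, by
        have := DFunLike.congr_fun (mem_nTorsion.1 x.2) i
        simpa using! this⟩
      invFun := fun y => ⟨Finsupp.equivFunOnFinite.symm fun i => (y i).1, by
        rw [mem_nTorsion]
        ext i
        have := mem_nTorsion.1 (y i).2
        simpa using! this⟩
      left_inv := fun x => by ext i; rfl
      right_inv := fun y => by ext i; rfl }
  rw [Nat.card_congr e, Nat.card_fun, card_nTorsion_padicQuot]

theorem finite_of_finite_nTorsion_finsupp_padicQuot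
    (h : Finite (nTorsion (α →₀ PadicQuot q) q)) : Finite α := by
  have hcard := card_nTorsion_padicQuot q
  obtain ⟨x, hx⟩ : ∃ x : nTorsion (PadicQuot q) q, x ≠ 0 := by
    have : Nontrivial (nTorsion (PadicQuot q) q) := by
      have : Finite (nTorsion (PadicQuot q) q) :=
        Nat.finite_of_card_ne_zero (by rw [hcard]; exact q.2.ne_zero)
      rw [← Finite.one_lt_card_iff_nontrivial, hcard]
      exact q.2.one_lt
    exact exists_ne 0
  refine Finite.of_injective (β := nTorsion (α →₀ PadicQuot q) q)
    (fun i => ⟨Finsupp.single i x.1, ?_⟩) ?_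
  · rw [mem_nTorsion, Finsupp.smul_single, mem_nTorsion.1 x.2, Finsupp.single_zero]
  · intro i j hij
    have hx' : (x : PadicQuot q) ≠ 0 := fun h => hx (Subtype.ext h)
    exact Finsupp.single_left_injective hx' (congrArg Subtype.val hij)

end PadicQuot

/-! ### The structure of divisible groups -/

theorem baer_of_divisible {D : Type*} [AddCommGroup D]
    (hD : ∀ n : ℕ, n ≠ 0 → ∀ x : D, ∃ y, n • y = x) : Module.Baer ℤ D := by
  have : DivisibleBy D ℤ := divisibleByOfSMulRightSurj D ℤ (by
    intro n hn x
    obtain ⟨y, hy⟩ := hD n.natAbs (Int.natAbs_ne_zero.2 hn) x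
    rcases Int.natAbs_eq n with h | h
    · exact ⟨y, by dsimp only; rw [h, natCast_zsmul, hy]⟩
    · exact ⟨-y, by dsimp only; rw [h, neg_smul_neg, natCast_zsmul, hy]⟩)
  exact Module.Baer.of_divisible D

theorem card_eq_pow_finrank_zmod {V : Type*} [AddCommGroup V] [Finite V] (q : ℕ)
    [Fact q.Prime] [Module (ZMod q) V] : Nat.card V = q ^ Module.finrank (ZMod q) V := by
  have : Module.Finite (ZMod q) V := Module.Finite.of_finite
  rw [Module.natCard_eq_pow_finrank (K := ZMod q) (V := V), Nat.card_zmod]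

theorem exists_card_eq_pow {V : Type*} [AddCommGroup V] [Finite V] (q : ℕ) (hq : q.Prime)
    (hV : ∀ x : V, q • x = 0) : ∃ k, Nat.card V = q ^ k := by
  have : Fact q.Prime := ⟨hq⟩
  let _ : Module (ZMod q) V := AddCommGroup.zmodModule hV
  exact ⟨Module.finrank (ZMod q) V, card_eq_pow_finrank_zmod q⟩

theorem nonempty_addEquiv_of_finrank_eq {V W : Type*} [AddCommGroup V] [AddCommGroup W] [Finite V]
    [Finite W] (q : ℕ) [Fact q.Prime] [Module (ZMod q) V] [Module (ZMod q) W]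
    (h : Module.finrank (ZMod q) V = Module.finrank (ZMod q) W) : Nonempty (V ≃+ W) := by
  have : Module.Finite (ZMod q) V := Module.Finite.of_finite
  have : Module.Finite (ZMod q) W := Module.Finite.of_finite
  have e : V ≃ₗ[ZMod q] W := LinearEquiv.ofFinrankEq V W h
  exact ⟨e.toAddEquiv⟩

/-- Two finite groups of the same order that are killed by the prime `q` are isomorphic, as vector
spaces over `ℤ / q`. -/
theorem nonempty_addEquiv_of_card_eq {V W : Type*} [AddCommGroup V] [AddCommGroup W] [Finite V]
    [Finite W] (q : ℕ) (hq : q.Prime) (hV : ∀ x : V, q • x = 0) (hW : ∀ x : W, q • x = 0)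
    (h : Nat.card V = Nat.card W) : Nonempty (V ≃+ W) := by
  have : Fact q.Prime := ⟨hq⟩
  let _ : Module (ZMod q) V := AddCommGroup.zmodModule hV
  let _ : Module (ZMod q) W := AddCommGroup.zmodModule hW
  rw [card_eq_pow_finrank_zmod q, card_eq_pow_finrank_zmod (V := W) q] at h
  exact nonempty_addEquiv_of_finrank_eq q (Nat.pow_right_injective hq.two_le h)

/-- A divisible group splits as the direct sum of its torsion and of a torsion-free group. The
torsion is here recognized from the orders of its socle: an isomorphism of socles extends to the
divisible groups by injectivity, and the extension is automatically injective. -/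
theorem exists_torsionFree_complement {D : Type u} [AddCommGroup D]
    (hD : ∀ n : ℕ, n ≠ 0 → ∀ x : D, ∃ y, n • y = x)
    {S : Nat.Primes → Type v} [∀ q, AddCommGroup (S q)]
    (hSdiv : ∀ q, ∀ n : ℕ, n ≠ 0 → ∀ x : S q, ∃ y, n • y = x)
    (hSprim : ∀ (q : Nat.Primes) (x : S q), ∃ k, (q : ℕ) ^ k • x = 0)
    (hfin : ∀ q : Nat.Primes, Finite (nTorsion D q))
    (hcard : ∀ q : Nat.Primes, Nat.card (nTorsion (S q) q) = Nat.card (nTorsion D q)) :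
    ∃ C : AddSubgroup D, (∀ n : ℕ, n ≠ 0 → ∀ x : C, ∃ y, n • y = x) ∧
      (∀ n : ℕ, n ≠ 0 → ∀ x : C, n • x = 0 → x = 0) ∧ Nonempty (D ≃+ C × ⨁ q, S q) := by
  classical
  have hfinS : ∀ q : Nat.Primes, Finite (nTorsion (S q) q) := fun q => by
    refine Nat.finite_of_card_ne_zero ?_
    rw [hcard]
    have := hfin q
    exact Nat.card_pos.ne'
  have he : ∀ q : Nat.Primes, Nonempty (nTorsion (S q) q ≃+ nTorsion D q) := fun q => by
    have := hfin q
    have := hfinS q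
    exact nonempty_addEquiv_of_card_eq q q.2 (fun x => Subtype.ext (mem_nTorsion.1 x.2))
      (fun x => Subtype.ext (mem_nTorsion.1 x.2)) (hcard q)
  let e := fun q => (he q).some
  have hext : ∀ q : Nat.Primes, ∃ φ : S q →+ D, φ.comp (nTorsion (S q) q).subtype =
      (nTorsion D q).subtype.comp (e q).toAddMonoidHom := fun q =>
    (baer_of_divisible hD).extension_property_addMonoidHom _ Subtype.val_injective _
  choose φ hφ using hext
  have hφe : ∀ q (x : S q) (hx : x ∈ nTorsion (S q) q), φ q x = e q ⟨x, hx⟩ :=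
    fun q x hx => DFunLike.congr_fun (hφ q) ⟨x, hx⟩
  let Φ : (⨁ q, S q) →+ D := DirectSum.toAddMonoid φ
  have hΦof : ∀ q x, Φ (DirectSum.of S q x) = φ q x := fun q x => DirectSum.toAddMonoid_of _ _ _
  have hΦinj : Function.Injective Φ := by
    rw [injective_iff_map_eq_zero]
    intro x hx
    by_contra hx0
    obtain ⟨n, q, hn, hq⟩ := exists_ne_zero_nsmul_prime_eq_zero hSprim x hx0
    obtain ⟨hy, hof⟩ := directSum_eq_of_of_nsmul_eq_zero hSprim q _ hq
    have h0 : Φ (n • x) = 0 := by rw [map_nsmul, hx, smul_zero]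
    rw [hof, hΦof, hφe q _ hy, ZeroMemClass.coe_eq_zero, EmbeddingLike.map_eq_zero_iff] at h0
    have h0' : (n • x) q = 0 := congrArg Subtype.val h0
    rw [h0', map_zero] at hof
    exact hn hof
  have hSD : ∀ n : ℕ, n ≠ 0 → ∀ x : ⨁ q, S q, ∃ y, n • y = x := by
    intro n hn x
    induction x using DirectSum.induction_on with
    | zero => exact ⟨0, smul_zero _⟩
    | of q y =>
      obtain ⟨z, rfl⟩ := hSdiv q n hn y
      exact ⟨DirectSum.of S q z, by rw [map_nsmul]⟩
    | add y z hy hz =>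
      obtain ⟨a, rfl⟩ := hy
      obtain ⟨b, rfl⟩ := hz
      exact ⟨a + b, smul_add _ _ _⟩
  obtain ⟨ρ, hρ⟩ := (baer_of_divisible hSD).extension_property_addMonoidHom Φ hΦinj
    (AddMonoidHom.id _)
  have hρΦ : ∀ x, ρ (Φ x) = x := DFunLike.congr_fun hρ
  refine ⟨ρ.ker, ?_, ?_, ⟨?_⟩⟩
  · rintro n hn ⟨x, hx⟩
    rw [AddMonoidHom.mem_ker] at hx
    obtain ⟨y, rfl⟩ := hD n hn x
    refine ⟨⟨y - Φ (ρ y), ?_⟩, Subtype.ext ?_⟩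
    · rw [AddMonoidHom.mem_ker, map_sub, hρΦ, sub_self]
    · change n • (y - Φ (ρ y)) = n • y
      rw [smul_sub, ← map_nsmul, ← map_nsmul, hx, map_zero, sub_zero]
  · refine eq_zero_of_nsmul_eq_zero fun q hq => ?_
    obtain ⟨l, rfl⟩ : ∃ l : Nat.Primes, (l : ℕ) = q := ⟨⟨q, hq⟩, rfl⟩
    rintro ⟨x, hx⟩ hqx
    have hqx' : x ∈ nTorsion D l := congrArg Subtype.val hqx
    obtain ⟨⟨y, hy⟩, hyx⟩ := (e l).surjective ⟨x, hqx'⟩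
    have h1 : Φ (DirectSum.of S l y) = x := by
      rw [hΦof, hφe _ y hy, hyx]
    have h2 := hρΦ (DirectSum.of S l y)
    rw [h1, AddMonoidHom.mem_ker.1 hx] at h2
    refine Subtype.ext ?_
    change x = 0
    rw [← h1, ← h2, map_zero]
  · exact
      { toFun := fun x => (⟨x - Φ (ρ x), by
            rw [AddMonoidHom.mem_ker, map_sub, hρΦ, sub_self]⟩, ρ x)
        invFun := fun y => y.1 + Φ y.2
        left_inv := fun x => sub_add_cancel _ _
        right_inv := fun ⟨⟨c, hc⟩, s⟩ => by
          rw [AddMonoidHom.mem_ker] at hc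
          have h : ρ (c + Φ s) = s := by rw [map_add, hc, hρΦ, zero_add]
          refine Prod.ext (Subtype.ext ?_) h
          change c + Φ s - Φ (ρ (c + Φ s)) = c
          rw [h, add_sub_cancel_right]
        map_add' := fun x y => by
          refine Prod.ext (Subtype.ext ?_) (map_add ρ x y)
          change x + y - Φ (ρ (x + y)) = x - Φ (ρ x) + (y - Φ (ρ y))
          rw [map_add, map_add]
          abel }

/-- A torsion-free divisible group of cardinality `2 ^ ℵ₀` is a `ℚ`-vector space of dimension
`2 ^ ℵ₀`. -/
theorem nonempty_addEquiv_finsupp_rat {C : Type u} [AddCommGroup C]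
    (hdiv : ∀ n : ℕ, n ≠ 0 → ∀ x : C, ∃ y, n • y = x)
    (htf : ∀ n : ℕ, n ≠ 0 → ∀ x : C, n • x = 0 → x = 0)
    (hcard : Cardinal.mk C = Cardinal.continuum.{u}) :
    Nonempty (C ≃+ (Cardinal.continuum.{0}.out →₀ ℚ)) := by
  have : IsAddTorsionFree C := ⟨fun n hn x y hxy => by
    rw [← sub_eq_zero]
    refine htf n hn _ ?_
    rw [smul_sub, sub_eq_zero]
    exact hxy⟩
  -- The divisible hull is a `ℚ`-vector space, and `C` is its own divisible hull.
  have hbij : Function.Bijective (DivisibleHull.coeAddMonoidHom C) := by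
    refine ⟨DivisibleHull.coe_injective, fun x => ?_⟩
    induction x with
    | mk m s =>
      obtain ⟨y, rfl⟩ := hdiv s s.ne_zero m
      refine ⟨y, ?_⟩
      rw [DivisibleHull.coeAddMonoidHom_apply, DivisibleHull.mk_eq_mk_iff_smul_eq_smul]
      simp
  let e : C ≃+ DivisibleHull C := AddEquiv.ofBijective _ hbij
  let b := Module.Basis.ofVectorSpace ℚ (DivisibleHull C)
  obtain ⟨J, ⟨e'⟩⟩ : ∃ J : Type u, Nonempty (C ≃+ (J →₀ ℚ)) := ⟨_, ⟨e.trans b.repr.toAddEquiv⟩⟩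
  have hJ : Cardinal.mk (J →₀ ℚ) = Cardinal.continuum.{u} := by
    rw [← hcard, Cardinal.mk_congr e'.toEquiv]
  have hinf : Infinite J := by
    by_contra hJf
    rw [not_infinite_iff_finite] at hJf
    have : Cardinal.mk (J →₀ ℚ) ≤ Cardinal.aleph0 := Cardinal.mk_le_aleph0
    rw [hJ] at this
    exact absurd this (not_le.2 Cardinal.aleph0_lt_continuum)
  rw [Cardinal.mk_finsupp_lift_of_infinite, Cardinal.lift_uzero, Cardinal.mkRat,
    Cardinal.lift_aleph0, max_eq_left (Cardinal.aleph0_le_mk J)] at hJ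
  have hequiv : Nonempty (J ≃ Cardinal.continuum.{0}.out) := by
    rw [← Cardinal.lift_mk_eq'.{u, 0}, hJ, Cardinal.mk_out, Cardinal.lift_continuum,
      Cardinal.lift_continuum]
  exact ⟨e'.trans (Finsupp.domCongr hequiv.some)⟩

/-- A divisible group of cardinality `2 ^ ℵ₀` whose `q`-torsion has order `q ^ k q` for every prime
`q` is `ℚ^(2 ^ ℵ₀) ⊕ ⨁ q, (ℚ_q / ℤ_q)^(k q)`. -/
theorem hasJensenDecomposition_of_card {D : Type u} [AddCommGroup D]
    (hD : ∀ n : ℕ, n ≠ 0 → ∀ x : D, ∃ y, n • y = x)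
    (hcard : Cardinal.mk D = Cardinal.continuum.{u}) (k : Nat.Primes → ℕ)
    (hk : ∀ q : Nat.Primes, Nat.card (nTorsion D q) = (q : ℕ) ^ k q) :
    HasJensenDecomposition D (fun q => (k q : Cardinal.{0})) := by
  have hα : ∀ q, Finite (k q : Cardinal.{0}).out := fun q => by
    rw [← Cardinal.lt_aleph0_iff_finite, Cardinal.mk_out]
    exact Cardinal.natCast_lt_aleph0
  have hα' : ∀ q, Nat.card (k q : Cardinal.{0}).out = k q := fun q => by
    rw [Nat.card, Cardinal.mk_out, Cardinal.toNat_natCast]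
  obtain ⟨C, hdiv, htf, ⟨e⟩⟩ := exists_torsionFree_complement hD
    (S := fun q => (k q : Cardinal.{0}).out →₀ PadicQuot q)
    (fun q => finsupp_padicQuot_divisible q _) (fun q => finsupp_padicQuot_primary q _)
    (fun q => Nat.finite_of_card_ne_zero (by rw [hk]; exact pow_ne_zero _ q.2.ne_zero))
    (fun q => by rw [card_nTorsion_finsupp_padicQuot, hα', hk])
  have hS : Countable (⨁ q : Nat.Primes, ((k q : Cardinal.{0}).out →₀ PadicQuot q)) :=
    inferInstanceAs (Countable (Π₀ q : Nat.Primes, ((k q : Cardinal.{0}).out →₀ PadicQuot q)))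
  have hC : Cardinal.mk C = Cardinal.continuum.{u} := by
    refine le_antisymm ((Cardinal.mk_subtype_le _).trans hcard.le) ?_
    have h := Cardinal.mk_congr e.toEquiv
    rw [hcard, Cardinal.mk_prod, Cardinal.lift_uzero] at h
    by_contra hlt
    rw [not_le] at hlt
    have h1 := Cardinal.mul_lt_of_lt Cardinal.aleph0_lt_continuum.le hlt
      ((Cardinal.lift_le_aleph0.2 (Cardinal.mk_le_aleph0 (α := ⨁ q : Nat.Primes,
        ((k q : Cardinal.{0}).out →₀ PadicQuot q)))).trans_lt Cardinal.aleph0_lt_continuum)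
    rw [← h] at h1
    exact lt_irrefl _ h1
  obtain ⟨e'⟩ := nonempty_addEquiv_finsupp_rat hdiv htf hC
  exact ⟨e.trans (e'.prodCongr (AddEquiv.refl _))⟩

/-- The exponents of a decomposition are determined by the orders of the torsion subgroups. -/
theorem HasJensenDecomposition.exponent_eq {D : Type u} [AddCommGroup D]
    {n : Nat.Primes → Cardinal.{0}} (h : HasJensenDecomposition D n) (q : Nat.Primes)
    (hfin : Finite (nTorsion D q)) :
    ∃ k : ℕ, n q = k ∧ Nat.card (nTorsion D q) = (q : ℕ) ^ k := by
  obtain ⟨e⟩ := h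
  have hprim : ∀ (l : Nat.Primes) (x : (n l).out →₀ PadicQuot l), ∃ k, (l : ℕ) ^ k • x = 0 :=
    fun l => finsupp_padicQuot_primary l _
  let ψ : nTorsion ((n q).out →₀ PadicQuot q) q → nTorsion D q := fun y =>
    ⟨e.symm (0, DirectSum.of (fun l => (n l).out →₀ PadicQuot l) q y.1), by
      rw [mem_nTorsion, ← map_nsmul, Prod.smul_mk, smul_zero, ← map_nsmul, mem_nTorsion.1 y.2,
        map_zero, Prod.mk_zero_zero, map_zero]⟩
  have hψ : Function.Bijective ψ := by
    constructor
    · intro y z hyz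
      have h1 := e.symm.injective (congrArg Subtype.val hyz)
      exact Subtype.ext (DirectSum.of_injective (β := fun l => (n l).out →₀ PadicQuot l) q
        (congrArg Prod.snd h1))
    · rintro ⟨x, hx⟩
      rw [mem_nTorsion] at hx
      have h1 : (q : ℕ) • e x = 0 := by rw [← map_nsmul, hx, map_zero]
      have h2 : (e x).1 = 0 := by
        have h3 : (q : ℕ) • (e x).1 = 0 := congrArg Prod.fst h1
        ext i
        have h4 := DFunLike.congr_fun h3 i
        rw [Finsupp.smul_apply, Finsupp.zero_apply, smul_eq_zero] at h4
        exact h4.resolve_left q.2.ne_zero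
      obtain ⟨h5, h6⟩ := directSum_eq_of_of_nsmul_eq_zero hprim q (e x).2 (congrArg Prod.snd h1)
      refine ⟨⟨_, h5⟩, Subtype.ext ?_⟩
      change e.symm (0, DirectSum.of (fun l => (n l).out →₀ PadicQuot l) q _) = x
      rw [← h6, ← h2, Prod.mk.eta, AddEquiv.symm_apply_apply]
  have hα : Finite (n q).out :=
    finite_of_finite_nTorsion_finsupp_padicQuot q _ (Finite.of_injective ψ hψ.1)
  refine ⟨Nat.card (n q).out, ?_, ?_⟩
  · rw [Nat.card, Cardinal.cast_toNat_of_lt_aleph0 (Cardinal.lt_aleph0_of_finite _),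
      Cardinal.mk_out]
  · rw [← card_nTorsion_finsupp_padicQuot, Nat.card_congr (Equiv.ofBijective ψ hψ)]

/-! ### Torsion in a cokernel -/

theorem free_and_finite_of_injective {H G : Type*} [AddCommGroup H] [AddCommGroup G]
    [Module.Free ℤ G] [Module.Finite ℤ G] (φ : H →+ G) (hφ : Function.Injective φ) :
    Module.Free ℤ H ∧ Module.Finite ℤ H := by
  let e := LinearEquiv.ofInjective φ.toIntLinearMap hφ
  exact ⟨Module.Free.of_equiv e.symm, Module.Finite.equiv e.symm⟩

section Cokernel

variable {P : Type*} [AddCommGroup P] (d : P →+ P) (q : ℕ)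

/-- The subgroup of elements whose image under `d` is divisible by `q`. -/
abbrev divComap : AddSubgroup P := (nsmulAddMonoidHom (α := P) q).range.comap d

/-- If multiplication by `q` is injective on `P`, then sending `c` to `d c / q` identifies
`d⁻¹(q P) / (q P + ker d)` with the `q`-torsion of the cokernel of `d`. -/
theorem card_nTorsion_coker (hq : Function.Injective (nsmulAddMonoidHom (α := P) q)) :
    Nat.card (nTorsion (P ⧸ d.range) q) =
      ((nsmulAddMonoidHom (α := P) q).range ⊔ d.ker).relIndex (divComap d q) := by
  let m : P →+ P := nsmulAddMonoidHom (α := P) q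
  have hcomm : d.comp m = m.comp d := by
    ext x
    exact map_nsmul d q x
  have h1 : (d.range.comap m).map (QuotientAddGroup.mk' d.range) = nTorsion (P ⧸ d.range) q := by
    ext x
    constructor
    · rintro ⟨y, hy, rfl⟩
      exact (QuotientAddGroup.eq_zero_iff _).2 hy
    · intro hx
      obtain ⟨y, rfl⟩ := QuotientAddGroup.mk_surjective x
      exact ⟨y, (QuotientAddGroup.eq_zero_iff (N := d.range) (q • y)).1 hx, rfl⟩
  have h2 : m.range.map d = d.range.map m := by
    rw [AddMonoidHom.map_range, AddMonoidHom.map_range, hcomm]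
  have h3 : (divComap d q).map d = (d.range.comap m).map m := by
    rw [AddSubgroup.map_comap_eq, AddSubgroup.map_comap_eq, inf_comm]
  calc Nat.card (nTorsion (P ⧸ d.range) q) = d.range.relIndex (d.range.comap m) := by
        rw [← h1, ← AddSubgroup.relIndex_ker, QuotientAddGroup.ker_mk']
    _ = (d.range.map m).relIndex ((d.range.comap m).map m) :=
        (AddSubgroup.relIndex_map_map_of_injective _ _ hq).symm
    _ = (m.range.map d).relIndex ((divComap d q).map d) := by rw [h2, h3]
    _ = (m.range ⊔ d.ker).relIndex (divComap d q) := by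
        rw [← AddSubgroup.relIndex_comap, AddSubgroup.comap_map_eq]

theorem card_nTorsion_coker_mul [Module.Free ℤ d.ker] [Module.Finite ℤ d.ker]
    (hq : Function.Injective (nsmulAddMonoidHom (α := P) q)) :
    Nat.card (nTorsion (P ⧸ d.range) q) * q ^ Module.finrank ℤ d.ker =
      (nsmulAddMonoidHom (α := P) q).range.relIndex (divComap d q) := by
  let m : P →+ P := nsmulAddMonoidHom (α := P) q
  have hle : m.range ≤ divComap d q := by
    rintro _ ⟨x, rfl⟩
    exact ⟨d x, (map_nsmul d q x).symm⟩
  have hle' : d.ker ≤ divComap d q := fun x hx =>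
    ⟨0, by rw [map_zero, AddMonoidHom.mem_ker.1 hx]⟩
  have h1 : m.range.relIndex d.ker = q ^ Module.finrank ℤ d.ker := by
    rw [← AddSubgroup.index_range_nsmul, AddSubgroup.relIndex]
    congr 1
    ext ⟨x, hx⟩
    rw [AddSubgroup.mem_addSubgroupOf]
    constructor
    · rintro ⟨y, rfl⟩
      refine ⟨⟨y, hq ?_⟩, rfl⟩
      rw [map_zero]
      exact (map_nsmul d q y).symm.trans hx
    · rintro ⟨y, hy⟩
      exact ⟨y, congrArg Subtype.val hy⟩
  rw [card_nTorsion_coker d q hq, ← h1, ← AddSubgroup.relIndex_sup_left d.ker m.range, mul_comm]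
  exact AddSubgroup.relIndex_mul_relIndex _ _ _ le_sup_left (sup_le hle hle')

end Cokernel

/-! ### Decreasing sequences of subgroups of finite index -/

section SubgroupTower

variable {G : Type u} [AddCommGroup G] {L : ℕ → AddSubgroup G} (hL : Antitone L)

/-- The transition maps of the tower of inclusions attached to a decreasing sequence of
subgroups. -/
abbrev inclTower : ∀ n, L (n + 1) →+ L n := fun n => AddSubgroup.inclusion (hL n.le_succ)

/-- The map `(b n) ↦ (b n - b (n + 1))` on `∏ n, L n`. -/
abbrev inclDiff : (∀ n, L n) →+ (∀ n, L n) := towerDiff (A := fun n => L n) (inclTower hL)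

/-- The first derived limit of the tower of inclusions. -/
abbrev InclLim1 : Type u := TowerLim1 (A := fun n => L n) (inclTower hL)

theorem coe_inclDiff (b : ∀ n, L n) (n : ℕ) :
    (inclDiff hL b n : G) = b n - b (n + 1) := rfl

/-- `lim¹` vanishes for a sequence of subgroups that is eventually constant. -/
theorem subsingleton_towerLim1_of_stable (N : ℕ) (h : ∀ n, N ≤ n → L n ≤ L (n + 1)) :
    Subsingleton (InclLim1 hL) := by
  have hN : ∀ n, N ≤ n → L N ≤ L n := fun n hn => by
    induction n, hn using Nat.le_induction with
    | base => exact le_rfl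
    | succ n hn ih => exact ih.trans (h n hn)
  refine subsingleton_of_forall_eq 0 fun x => ?_
  obtain ⟨x, rfl⟩ := QuotientAddGroup.mk_surjective x
  rw [QuotientAddGroup.eq_zero_iff]
  have hmem : ∀ n, ∑ k ∈ Finset.range N, (x k : G) - ∑ k ∈ Finset.range n, (x k : G) ∈ L n := by
    intro n
    rcases le_total n N with hn | hn
    · rw [← Finset.sum_Ico_eq_sub _ hn]
      exact sum_mem fun k hk => hL (Finset.mem_Ico.1 hk).1 (x k).2
    · rw [← neg_sub, ← Finset.sum_Ico_eq_sub _ hn]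
      exact neg_mem (sum_mem fun k hk => hN n hn (hL (Finset.mem_Ico.1 hk).1 (x k).2))
  refine ⟨fun n => ⟨_, hmem n⟩, funext fun n => Subtype.ext ?_⟩
  rw [coe_inclDiff]
  dsimp only
  rw [Finset.sum_range_succ]
  abel

theorem exists_not_le_succ (h : Nontrivial (InclLim1 hL)) (N : ℕ) :
    ∃ n, N ≤ n ∧ ¬ L n ≤ L (n + 1) := by
  by_contra! hN
  have := subsingleton_towerLim1_of_stable hL N hN
  exact not_subsingleton (InclLim1 hL) this

/-- The kernel of `towerDiff` consists of the constant sequences in `⋂ n, L n`. -/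
theorem inclDiff_ker_injective :
    Function.Injective ((AddMonoidHom.comp (L 0).subtype (Pi.evalAddMonoidHom (fun n => L n) 0)).comp
      (inclDiff hL).ker.subtype) := by
  rw [injective_iff_map_eq_zero]
  rintro ⟨b, hb⟩ h0
  have h0' : (b 0 : G) = 0 := h0
  refine Subtype.ext (funext fun n => Subtype.ext ?_)
  change (b n : G) = 0
  induction n with
  | zero => exact h0'
  | succ n ih =>
    have h := congrArg Subtype.val (congrFun (AddMonoidHom.mem_ker.1 hb) n)
    rw [coe_inclDiff, ih] at h
    simpa using! h

/-- The sequences in `∏ n, L n` whose class modulo `q` is compatible, that is, lies in the limit of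
the groups `L n / q L n`. -/
abbrev compatMod (q : ℕ) : AddSubgroup (∀ n, L n) := divComap (inclDiff hL) q

theorem mem_compatMod (q : ℕ) {c : ∀ n, L n} :
    c ∈ compatMod hL q ↔ ∀ n, ∃ z ∈ L n, q • z = (c n : G) - c (n + 1) := by
  constructor
  · rintro ⟨y, hy⟩ n
    exact ⟨y n, (y n).2, congrArg Subtype.val (congrFun hy n)⟩
  · intro h
    choose z hz hzc using h
    exact ⟨fun n => ⟨z n, hz n⟩, funext fun n => Subtype.ext (hzc n)⟩

variable [Module.Free ℤ G] [Module.Finite ℤ G]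

theorem free_and_finite_addSubgroup (H : AddSubgroup G) :
    Module.Free ℤ H ∧ Module.Finite ℤ H :=
  free_and_finite_of_injective H.subtype Subtype.val_injective

theorem index_range_nsmul_of_finiteIndex (H : AddSubgroup G) [H.FiniteIndex] (q : ℕ) :
    (nsmulAddMonoidHom (α := H) q).range.index = q ^ Module.finrank ℤ G := by
  obtain ⟨_, _⟩ := free_and_finite_addSubgroup H
  rw [AddSubgroup.index_range_nsmul, AddSubgroup.finrank_eq_of_finiteIndex]

/-- Multiplication by `q ≠ 0` is injective on `∏ n, L n`. -/
theorem nsmul_pi_injective (q : ℕ) (hq : q ≠ 0) :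
    Function.Injective (nsmulAddMonoidHom (α := ∀ n, L n) q) := by
  intro x y hxy
  funext n
  have h := congrFun hxy n
  obtain ⟨_, _⟩ := free_and_finite_addSubgroup (L n)
  exact AddSubgroup.nsmulAddMonoidHom_injective_of_isTorsionFree hq h

/-- The order of the limit of the groups `L n / q L n`. -/
noncomputable abbrev limModCard (q : ℕ) : ℕ :=
  (nsmulAddMonoidHom (α := ∀ n, L n) q).range.relIndex (compatMod hL q)

theorem card_nTorsion_towerLim1 (q : ℕ) (hq : q ≠ 0) :
    Nat.card (nTorsion (InclLim1 hL) q) *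
      q ^ Module.finrank ℤ (inclDiff hL).ker = limModCard hL q := by
  obtain ⟨_, _⟩ := free_and_finite_of_injective _ (inclDiff_ker_injective hL)
  exact card_nTorsion_coker_mul _ q (nsmul_pi_injective q hq)

/-- For a sequence of subgroups that is not eventually constant, `lim¹` has cardinality `2 ^ ℵ₀`.
Choosing `z n ∈ L n \ L (n + 1)` for `n` in an infinite set, the classes of the families supported
on subsets of that set fall into countable fibres, because a sequence `b` with given `towerDiff b`
is determined by `b 0`. -/
theorem mk_towerLim1 (h : ∀ N, ∃ n, N ≤ n ∧ ¬ L n ≤ L (n + 1)) :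
    Cardinal.mk (InclLim1 hL) = Cardinal.continuum.{u} := by
  classical
  have hG : Countable G := (Module.finBasis ℤ G).equivFun.toEquiv.countable_iff.2 inferInstance
  refine le_antisymm ?_ ?_
  · have h1 : Cardinal.mk (InclLim1 hL) ≤ Cardinal.mk (ℕ → G) :=
      (Cardinal.mk_le_of_surjective QuotientAddGroup.mk_surjective).trans
        (Cardinal.mk_le_of_injective (f := fun (c : ∀ n, L n) n => (c n : G)) fun a b hab =>
          funext fun n => Subtype.ext (congrFun hab n))
    refine h1.trans ?_
    rw [Cardinal.mk_arrow, Cardinal.mk_nat, Cardinal.lift_aleph0, Cardinal.lift_uzero,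
      ← Cardinal.aleph0_power_aleph0]
    exact Cardinal.power_le_power_right Cardinal.mk_le_aleph0
  · let S : Set ℕ := {n | ¬ L n ≤ L (n + 1)}
    have hS : S.Infinite := Set.infinite_of_forall_exists_gt fun N => by
      obtain ⟨n, hn, hn'⟩ := h (N + 1)
      exact ⟨n, hn', hn⟩
    have hz : ∀ n, ∃ z : L n, n ∈ S → (z : G) ∉ L (n + 1) := fun n => by
      by_cases hn : n ∈ S
      · obtain ⟨z, hz, hz'⟩ := SetLike.not_le_iff_exists.1 hn
        exact ⟨⟨z, hz⟩, fun _ => hz'⟩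
      · exact ⟨0, fun h => absurd h hn⟩
    choose z hz using hz
    let x : Set S → ∀ n, L n := fun ε n => if n ∈ Subtype.val '' ε then z n else 0
    have hb : ∀ ε, ∃ b, inclDiff hL b =
        -(x ε : InclLim1 hL).out + x ε := fun ε => by
      have h1 : (((x ε : InclLim1 hL).out : ∀ n, L n) : InclLim1 hL) = x ε :=
        QuotientAddGroup.out_eq' _
      exact QuotientAddGroup.eq.1 h1
    choose b hb using hb
    have hinj : Function.Injective (fun ε : Set S =>
        ((x ε : InclLim1 hL), (b ε 0 : G))) := by
      intro ε ε' hεε'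
      obtain ⟨h1, h2⟩ := Prod.ext_iff.1 hεε'
      dsimp only at h1 h2
      have hdiff : ∀ n, (b ε n : G) - b ε (n + 1) - (b ε' n - b ε' (n + 1)) = x ε n - x ε' n := by
        intro n
        have h3 := congrArg Subtype.val (congrFun (hb ε) n)
        have h4 := congrArg Subtype.val (congrFun (hb ε') n)
        rw [← h1] at h4
        rw [coe_inclDiff] at h3 h4
        rw [h3, h4]
        change -_ + (x ε n : G) - (-_ + (x ε' n : G)) = _
        abel
      have hstep : ∀ n, (b ε n : G) = b ε' n →
          (x ε n : G) - x ε' n ∈ L (n + 1) ∧ (x ε n = x ε' n → (b ε (n + 1) : G) = b ε' (n + 1)) := by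
        intro n hn
        have h5 := hdiff n
        rw [hn] at h5
        constructor
        · rw [← h5]
          convert sub_mem (b ε' (n + 1)).2 (b ε (n + 1)).2 using 1
          abel
        · intro h6
          rw [h6, sub_self] at h5
          rw [← sub_eq_zero, ← neg_eq_zero, ← h5]
          abel
      have hS' : ∀ n, (x ε n : G) - x ε' n ∈ L (n + 1) →
          x ε n = x ε' n ∧ (n ∈ S → (n ∈ Subtype.val '' ε ↔ n ∈ Subtype.val '' ε')) := by
        intro n hn
        by_cases hnS : n ∈ S
        · have hzn := hz n hnS
          by_cases h7 : n ∈ Subtype.val '' ε <;> by_cases h8 : n ∈ Subtype.val '' ε'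
          · exact ⟨by simp only [x, if_pos h7, if_pos h8], fun _ => iff_of_true h7 h8⟩
          · simp only [x, if_pos h7, if_neg h8, ZeroMemClass.coe_zero, sub_zero] at hn
            exact absurd hn hzn
          · simp only [x, if_neg h7, if_pos h8, ZeroMemClass.coe_zero, zero_sub,
              neg_mem_iff] at hn
            exact absurd hn hzn
          · exact ⟨by simp only [x, if_neg h7, if_neg h8], fun _ => iff_of_false h7 h8⟩
        · have hno : ∀ ε : Set S, n ∉ Subtype.val '' ε := by
            rintro ε ⟨m, -, rfl⟩
            exact hnS m.2
          exact ⟨by simp only [x, if_neg (hno _)], fun h => absurd h hnS⟩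
      have hall : ∀ n, (b ε n : G) = b ε' n := by
        intro n
        induction n with
        | zero => exact h2
        | succ n ih => exact (hstep n ih).2 (hS' n (hstep n ih).1).1
      have hiff := fun n => (hS' n (hstep n (hall n)).1).2
      ext ⟨n, hn⟩
      have h9 := hiff n hn
      simpa [hn] using! h9
    have hle := Cardinal.lift_mk_le_lift_mk_of_injective hinj
    have : Infinite S := hS.to_subtype
    rw [Cardinal.mk_set, Cardinal.mk_eq_aleph0 S, Cardinal.two_power_aleph0,
      Cardinal.lift_continuum, Cardinal.lift_uzero, Cardinal.mk_prod, Cardinal.lift_id,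
      Cardinal.lift_id] at hle
    by_contra hlt
    rw [not_le] at hlt
    exact absurd hle (not_le.2 (Cardinal.mul_lt_of_lt Cardinal.aleph0_lt_continuum.le hlt
      ((Cardinal.mk_le_aleph0 (α := G)).trans_lt Cardinal.aleph0_lt_continuum)))

variable [∀ n, (L n).FiniteIndex]

/-- `lim¹` of the tower is divisible, because `lim¹` of the tower of finite groups `L n / m L n`
vanishes. -/
theorem towerLim1_divisible (m : ℕ) (hm : m ≠ 0) (x : InclLim1 hL) :
    ∃ y, m • y = x := by
  obtain ⟨x, rfl⟩ := QuotientAddGroup.mk_surjective x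
  have hfin : ∀ n, Finite (L n ⧸ (nsmulAddMonoidHom (α := L n) m).range) := fun n => by
    refine Nat.finite_of_card_ne_zero ?_
    rw [← AddSubgroup.index_eq_card, index_range_nsmul_of_finiteIndex]
    exact pow_ne_zero _ hm
  let g : ∀ n, (L (n + 1) ⧸ (nsmulAddMonoidHom (α := L (n + 1)) m).range) →+
      (L n ⧸ (nsmulAddMonoidHom (α := L n) m).range) := fun n =>
    QuotientAddGroup.map _ _ (inclTower hL n) (by
      rintro _ ⟨y, rfl⟩
      exact ⟨inclTower hL n y, (map_nsmul (inclTower hL n) m y).symm⟩)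
  obtain ⟨b, hb⟩ := towerDiff_surjective_of_finite
    (A := fun n => L n ⧸ (nsmulAddMonoidHom (α := L n) m).range) g (fun n => (x n : _ ⧸ _))
  choose c hc using fun n => QuotientAddGroup.mk_surjective (b n)
  have hmem : ∀ n, x n - inclDiff hL c n ∈ (nsmulAddMonoidHom (α := L n) m).range := by
    intro n
    rw [← QuotientAddGroup.eq_zero_iff, QuotientAddGroup.mk_sub, sub_eq_zero]
    have h := congrFun hb n
    rw [towerDiff_apply, ← hc, ← hc] at h
    exact h.symm
  choose y hy using hmem
  refine ⟨(y : InclLim1 hL), ?_⟩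
  rw [← QuotientAddGroup.mk_nsmul, QuotientAddGroup.eq]
  refine ⟨c, funext fun n => ?_⟩
  have h : m • y n = x n - inclDiff hL c n := hy n
  change _ = -(m • y n) + x n
  rw [h]
  abel

variable (q : ℕ)

/-- The limit of the groups `L n / q L n` embeds into all `L n / q L n` with large `n`, since the
images in these groups have bounded orders. -/
theorem exists_compatMod_stable (hq : q ≠ 0) : ∃ N, ∀ n, N ≤ n → ∀ c ∈ compatMod hL q,
    c n ∈ (nsmulAddMonoidHom (α := L n) q).range →
      c ∈ (nsmulAddMonoidHom (α := ∀ n, L n) q).range := by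
  let K : ℕ → AddSubgroup (∀ n, L n) := fun n =>
    (nsmulAddMonoidHom (α := L n) q).range.comap (Pi.evalAddMonoidHom (fun n => L n) n) ⊓
      compatMod hL q
  have hKle : ∀ n, K n ≤ compatMod hL q := fun n => inf_le_right
  have hK : Antitone K := by
    refine antitone_nat_of_succ_le fun n => ?_
    rintro c ⟨⟨y, hy⟩, hc⟩
    refine ⟨?_, hc⟩
    obtain ⟨z, hz, hzc⟩ := (mem_compatMod hL q).1 hc n
    refine ⟨⟨z + y, add_mem hz (hL n.le_succ y.2)⟩, Subtype.ext ?_⟩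
    have hy' : q • (y : G) = c (n + 1) := congrArg Subtype.val hy
    change q • (z + y) = (c n : G)
    rw [smul_add, hzc, hy', sub_add_cancel]
  have hidx : ∀ n, (K n).relIndex (compatMod hL q) ∣ q ^ Module.finrank ℤ G := fun n => by
    rw [AddSubgroup.inf_relIndex_right, AddSubgroup.relIndex_comap,
      ← index_range_nsmul_of_finiteIndex (L n)]
    exact AddSubgroup.relIndex_dvd_index_of_normal _ _
  have hpos : 0 < q ^ Module.finrank ℤ G := pow_pos (Nat.pos_of_ne_zero hq) _
  obtain ⟨N, hN⟩ : ∃ N, ∀ n, (K n).relIndex (compatMod hL q) ≤ (K N).relIndex (compatMod hL q) := by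
    have hfin : (Set.range fun n => (K n).relIndex (compatMod hL q)).Finite :=
      (Set.finite_Iic (q ^ Module.finrank ℤ G)).subset (by
        rintro _ ⟨n, rfl⟩
        exact Nat.le_of_dvd hpos (hidx n))
    obtain ⟨_, ⟨N, rfl⟩, hN⟩ := Set.exists_max_image _ id hfin (Set.range_nonempty _)
    exact ⟨N, fun n => hN _ ⟨n, rfl⟩⟩
  have hNle : ∀ m, K N ≤ K m := by
    intro m
    rcases le_total m N with hm | hm
    · exact hK hm
    · have h1 := AddSubgroup.relIndex_mul_relIndex _ _ _ (hK hm) (hKle N)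
      have h2 : (K N).relIndex (compatMod hL q) ≠ 0 := fun h =>
        hpos.ne' (zero_dvd_iff.1 (h ▸ hidx N))
      have h3 : (K m).relIndex (compatMod hL q) ≠ 0 := fun h =>
        hpos.ne' (zero_dvd_iff.1 (h ▸ hidx m))
      have h4 : (K m).relIndex (K N) ≤ 1 := by
        refine Nat.le_of_mul_le_mul_right ?_ (Nat.pos_of_ne_zero h2)
        rw [h1, one_mul]
        exact hN m
      have h5 : (K m).relIndex (K N) ≠ 0 := fun h => h3 (by rw [← h1, h, zero_mul])
      exact AddSubgroup.relIndex_eq_one.1 (le_antisymm h4 (Nat.one_le_iff_ne_zero.2 h5))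
  refine ⟨N, fun n hn c hc hcn => ?_⟩
  have hmem : ∀ m, c m ∈ (nsmulAddMonoidHom (α := L m) q).range := fun m =>
    (hNle m (hK hn ⟨hcn, hc⟩)).1
  choose y hy using hmem
  exact ⟨y, funext hy⟩

theorem exists_limModCard_eq (hq : q ≠ 0) : ∃ N, ∀ n, N ≤ n → limModCard hL q =
    (nsmulAddMonoidHom (α := L n) q).range.relIndex
      ((compatMod hL q).map (Pi.evalAddMonoidHom (fun n => L n) n)) := by
  obtain ⟨N, hN⟩ := exists_compatMod_stable hL q hq
  refine ⟨N, fun n hn => ?_⟩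
  rw [← AddSubgroup.relIndex_comap, limModCard, ← AddSubgroup.inf_relIndex_right,
    ← AddSubgroup.inf_relIndex_right (AddSubgroup.comap _ _)]
  congr 1
  ext c
  constructor
  · rintro ⟨⟨y, rfl⟩, hc⟩
    exact ⟨⟨y n, rfl⟩, hc⟩
  · rintro ⟨hcn, hc⟩
    exact ⟨hN n hn c hc hcn, hc⟩

theorem limModCard_dvd (hq : q ≠ 0) : limModCard hL q ∣ q ^ Module.finrank ℤ G := by
  obtain ⟨N, hN⟩ := exists_limModCard_eq hL q hq
  rw [hN N le_rfl, ← index_range_nsmul_of_finiteIndex (L N)]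
  exact AddSubgroup.relIndex_dvd_index_of_normal _ _

/-- If the subquotients are `p`-groups and `l` is prime to `p`, then every class modulo `l` is
compatible: `x` extends to the sequence of its multiples by `(p ^ (l - 1)) ^ k n ≡ 1` modulo `l`,
where `p ^ k n` carries `x` into `L n`. -/
theorem limModCard_eq_of_ne {p l : ℕ} (hp : p.Prime) (hl : l.Prime) (hlp : l ≠ p)
    (hpL : ∀ n m, ∀ x ∈ L n, ∃ k, p ^ k • x ∈ L m) :
    limModCard hL l = l ^ Module.finrank ℤ G := by
  classical
  obtain ⟨N, hN⟩ := exists_limModCard_eq hL l hl.ne_zero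
  rw [hN N le_rfl, ← index_range_nsmul_of_finiteIndex (L N), ← AddSubgroup.relIndex_top_right]
  congr 1
  rw [eq_top_iff]
  rintro ⟨x, hx⟩ -
  let k : ℕ → ℕ := fun n => Nat.find (hpL N n x hx)
  have hk : ∀ n, p ^ k n • x ∈ L n := fun n => Nat.find_spec (hpL N n x hx)
  have hkmono : ∀ n, k n ≤ k (n + 1) := fun n =>
    Nat.find_min' (hpL N n x hx) (hL n.le_succ (hk (n + 1)))
  have hkN : k N = 0 := Nat.le_zero.1 (Nat.find_min' (hpL N N x hx) (by simpa using hx))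
  have hc : ∀ n, ((p ^ (l - 1)) ^ k n) • x ∈ L n := fun n => by
    obtain ⟨t, ht⟩ := Nat.exists_eq_succ_of_ne_zero (Nat.sub_pos_of_lt hl.one_lt).ne'
    rw [ht, ← pow_mul, Nat.succ_mul, pow_add, mul_smul]
    exact nsmul_mem (hk n) _
  refine ⟨fun n => ⟨_, hc n⟩, (mem_compatMod hL l).2 fun n => ?_, Subtype.ext ?_⟩
  · obtain ⟨t, ht⟩ := Nat.exists_eq_add_of_le (hkmono n)
    have hmod : (p ^ (l - 1)) ^ t ≡ 1 [MOD l] := by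
      have h := Nat.ModEq.pow_totient ((Nat.coprime_primes hp hl).2 hlp.symm)
      rw [Nat.totient_prime hl] at h
      simpa using h.pow t
    obtain ⟨u, hu⟩ := (Nat.modEq_iff_dvd.1 hmod)
    refine ⟨u • (p ^ (l - 1)) ^ k n • x, zsmul_mem (hc n) u, ?_⟩
    dsimp only
    rw [ht, pow_add, mul_comm _ ((p ^ (l - 1)) ^ t), mul_smul ((p ^ (l - 1)) ^ t)]
    generalize (p ^ (l - 1)) ^ k n • x = y
    rw [← natCast_zsmul, ← mul_smul, ← hu, sub_smul, Nat.cast_one, one_smul, natCast_zsmul]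
  · change (p ^ (l - 1)) ^ k N • x = x
    rw [hkN, pow_zero, one_smul]

/-- If the subquotients are `p`-groups and the limit of the groups `L n / p L n` has maximal order,
then eventually `L n = L (n + 1) + p L n`, which forces the sequence to be eventually constant. -/
theorem exists_stable_of_limModCard_eq {p : ℕ} (hp : p.Prime)
    (hpL : ∀ n m, ∀ x ∈ L n, ∃ k, p ^ k • x ∈ L m)
    (h : limModCard hL p = p ^ Module.finrank ℤ G) : ∃ N, ∀ n, N ≤ n → L n ≤ L (n + 1) := by
  obtain ⟨N, hN⟩ := exists_limModCard_eq hL p hp.ne_zero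
  refine ⟨N, fun n hn => ?_⟩
  have htop : (nsmulAddMonoidHom (α := L n) p).range ⊔
      ((compatMod hL p).map (Pi.evalAddMonoidHom (fun n => L n) n)) = ⊤ := by
    have h1 := hN n hn
    rw [h, ← index_range_nsmul_of_finiteIndex (L n), ← AddSubgroup.relIndex_sup_left] at h1
    have h2 := AddSubgroup.relIndex_mul_index (H := (nsmulAddMonoidHom (α := L n) p).range)
      (K := (nsmulAddMonoidHom (α := L n) p).range ⊔
        ((compatMod hL p).map (Pi.evalAddMonoidHom (fun n => L n) n))) le_sup_left
    rw [← h1] at h2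
    have h3 : (nsmulAddMonoidHom (α := L n) p).range.index ≠ 0 := by
      rw [index_range_nsmul_of_finiteIndex]
      exact pow_ne_zero _ hp.ne_zero
    exact AddSubgroup.index_eq_one.1 (Nat.eq_of_mul_eq_mul_left (Nat.pos_of_ne_zero h3)
      (h2.trans (mul_one _).symm))
  -- Multiplication by `p` on the finite group `L n / L (n + 1)` is surjective, hence injective.
  let Q := L n ⧸ (L (n + 1)).addSubgroupOf (L n)
  have hQfin : Finite Q := by
    have : (L (n + 1)).addSubgroupOf (L n) |>.FiniteIndex := inferInstance
    exact AddSubgroup.finite_quotient_of_finiteIndex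
  have hsurj : Function.Surjective (fun x : Q => p • x) := by
    intro x
    obtain ⟨x, rfl⟩ := QuotientAddGroup.mk_surjective x
    have hx : x ∈ (nsmulAddMonoidHom (α := L n) p).range ⊔
      ((compatMod hL p).map (Pi.evalAddMonoidHom (fun n => L n) n)) := htop ▸ AddSubgroup.mem_top x
    obtain ⟨_, ⟨z, rfl⟩, _, ⟨c, hc, rfl⟩, rfl⟩ := AddSubgroup.mem_sup.1 hx
    obtain ⟨w, hw, hwc⟩ := (mem_compatMod hL p).1 hc n
    refine ⟨((z + ⟨w, hw⟩ : L n) : Q), ?_⟩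
    dsimp only
    rw [← QuotientAddGroup.mk_nsmul, QuotientAddGroup.eq, AddSubgroup.mem_addSubgroupOf]
    change -(p • ((z : G) + w)) + (p • (z : G) + c n) ∈ L (n + 1)
    rw [smul_add, hwc]
    convert (c (n + 1)).2 using 1
    abel
  have hinj : Function.Injective (fun x : Q => p • x) := Finite.injective_iff_surjective.2 hsurj
  have hinj' : ∀ k, ∀ x : Q, p ^ k • x = 0 → x = 0 := by
    intro k
    induction k with
    | zero => intro x hx; simpa using hx
    | succ k ih =>
      intro x hx
      rw [pow_succ, mul_smul] at hx
      exact hinj ((ih _ hx).trans (smul_zero p).symm)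
  intro x hx
  obtain ⟨k, hk⟩ := hpL n (n + 1) x hx
  have h0 := hinj' k ((⟨x, hx⟩ : L n) : Q) ((QuotientAddGroup.eq_zero_iff _).2 hk)
  exact (QuotientAddGroup.eq_zero_iff (N := (L (n + 1)).addSubgroupOf (L n)) _).1 h0

end SubgroupTower

section SubgroupTower

variable {G : Type u} [AddCommGroup G] {L : ℕ → AddSubgroup G} (hL : Antitone L)
  [Module.Free ℤ G] [Module.Finite ℤ G] [∀ n, (L n).FiniteIndex]

/-- The exponents `k q` of the torsion of `lim¹`, and the rank `s` of `⋂ n, L n`. -/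
theorem exists_torsion_exponents : ∃ (k : Nat.Primes → ℕ) (s : ℕ), ∀ q : Nat.Primes,
    Nat.card (nTorsion (InclLim1 hL) q) = (q : ℕ) ^ k q ∧
      (q : ℕ) ^ (k q + s) = limModCard hL q ∧ k q + s ≤ Module.finrank ℤ G := by
  have h : ∀ q : Nat.Primes, ∃ k, Nat.card (nTorsion (InclLim1 hL) q) = (q : ℕ) ^ k := fun q => by
    have hfin : Finite (nTorsion (InclLim1 hL) q) := by
      refine Nat.finite_of_card_ne_zero fun h0 => ?_
      have h1 := limModCard_dvd hL q q.2.ne_zero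
      rw [← card_nTorsion_towerLim1 hL q q.2.ne_zero, h0, zero_mul, zero_dvd_iff] at h1
      exact pow_ne_zero _ q.2.ne_zero h1
    exact exists_card_eq_pow q q.2 fun x => Subtype.ext (mem_nTorsion.1 x.2)
  choose k hk using h
  have hcard : ∀ q : Nat.Primes,
      (q : ℕ) ^ (k q + Module.finrank ℤ (inclDiff hL).ker) = limModCard hL q := fun q => by
    rw [← card_nTorsion_towerLim1 hL q q.2.ne_zero, hk, pow_add]
  refine ⟨k, Module.finrank ℤ (inclDiff hL).ker, fun q => ⟨hk q, hcard q, ?_⟩⟩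
  have h1 := limModCard_dvd hL q q.2.ne_zero
  rw [← hcard] at h1
  exact (Nat.pow_dvd_pow_iff_le_right q.2.one_lt).1 h1

end SubgroupTower

/-! ### Replacing a tower of finitely generated groups by a sequence of subgroups -/

theorem HasJensenDecomposition.congr {G : Type u} {H : Type v} [AddCommGroup G] [AddCommGroup H]
    (e : G ≃+ H) {n : Nat.Primes → Cardinal.{0}} (h : HasJensenDecomposition G n) :
    HasJensenDecomposition H n :=
  h.map fun e' => e.symm.trans e'

theorem finite_of_finrank_eq_zero {M : Type*} [AddCommGroup M] [Module.Finite ℤ M]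
    (h : Module.finrank ℤ M = 0) : Finite M :=
  Module.finite_of_fg_torsion M (Module.finrank_eq_zero_iff_isTorsion.1 h)

section Reduction

variable {I : Type v} [Preorder I] {A : I → Type u} [∀ i, AddCommGroup (A i)]
  (f : ∀ ⦃i j : I⦄, i ≤ j → A j →+ A i)
  (hf : InverseSystem (fun i j (h : i ≤ j) => (f h : A j → A i)))
  (hfg : ∀ i, AddGroup.FG (A i)) (r : ℕ) (hrank : ∀ i, Module.finrank ℤ (A i) = r)
  (hcoker : ∀ ⦃i j : I⦄ (h : i ≤ j), Finite (A i ⧸ (f h).range))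
  [IsDirectedOrder I] [Countable I] [Nonempty I]

include hf hfg hrank hcoker in
/-- The system may be replaced by a decreasing sequence of finite index subgroups `L n` of a free
group `G` of rank `r`: `G` is the first group of a cofinal sequence modulo its torsion, `L n` is the
image of the `n`-th group, and the rank condition makes the kernels finite. -/
theorem exists_subgroup_tower : ∃ (G : Type u) (_ : AddCommGroup G) (_ : Module.Free ℤ G)
    (_ : Module.Finite ℤ G) (L : ℕ → AddSubgroup G) (hL : Antitone L)
    (_ : ∀ n, (L n).FiniteIndex), Module.finrank ℤ G = r ∧ Nonempty (Lim1 f ≃+ InclLim1 hL) ∧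
      ∀ p : ℕ, (∀ ⦃i j : I⦄ (h : i ≤ j), IsPGroup p (Multiplicative (A i ⧸ (f h).range))) →
        ∀ n m, ∀ x ∈ L n, ∃ k, p ^ k • x ∈ L m := by
  obtain ⟨s, hs, hst⟩ := Filter.exists_seq_monotone_tendsto_atTop_atTop I
  have hcof : ∀ i, ∃ n, i ≤ s n := fun i => (hst.eventually_ge_atTop i).exists
  have hfin : ∀ i, Module.Finite ℤ (A i) := fun i => Module.Finite.iff_addGroup_fg.2 (hfg i)
  let T := Submodule.torsion ℤ (A (s 0))
  let G := A (s 0) ⧸ T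
  have hfree : Module.Free ℤ G := inferInstance
  let mk : A (s 0) →+ G := T.mkQ.toAddMonoidHom
  have hmk : Function.Surjective mk := T.mkQ_surjective
  let g : ∀ n, A (s n) →+ G := fun n => mk.comp (f (hs (Nat.zero_le n)))
  have hg : ∀ n x, g n (f (hs n.le_succ) x) = g (n + 1) x := fun n x =>
    congrArg mk (hf.map_map (hs (Nat.zero_le n)) (hs n.le_succ) x)
  let L : ℕ → AddSubgroup G := fun n => (g n).range
  have hL : Antitone L := antitone_nat_of_succ_le fun n => by
    rintro _ ⟨x, rfl⟩
    exact ⟨_, hg n x⟩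
  have hidx : ∀ n, (L n).FiniteIndex := fun n => by
    have : (f (hs (Nat.zero_le n))).range.FiniteIndex := by
      have := hcoker (hs (Nat.zero_le n))
      exact AddSubgroup.finiteIndex_of_finite_quotient
    have hLn : L n = (f (hs (Nat.zero_le n))).range.map mk := (AddMonoidHom.map_range _ _).symm
    refine ⟨fun h0 => AddSubgroup.FiniteIndex.index_ne_zero
      (H := (f (hs (Nat.zero_le n))).range) ?_⟩
    have hdvd := AddSubgroup.index_map_dvd (f (hs (Nat.zero_le n))).range hmk
    rw [← hLn, h0] at hdvd
    exact zero_dvd_iff.1 hdvd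
  have hGr : Module.finrank ℤ G = r := by
    have h1 := Submodule.finrank_quotient_add_finrank T
    have h2 : Module.finrank ℤ T = 0 :=
      Module.finrank_eq_zero_iff_isTorsion.2 (Submodule.torsion_isTorsion)
    rw [h2, add_zero, hrank] at h1
    exact h1
  have hker : ∀ n, Finite (g n).rangeRestrict.ker := fun n => by
    rw [AddMonoidHom.ker_rangeRestrict]
    have h1 := Submodule.finrank_quotient_add_finrank (LinearMap.ker (g n).toIntLinearMap)
    have h2 : Module.finrank ℤ (L n) = r := by
      rw [AddSubgroup.finrank_eq_of_finiteIndex, hGr]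
    have h3 : Module.finrank ℤ (LinearMap.range (g n).toIntLinearMap) = r := h2
    rw [(LinearMap.quotKerEquivRange (g n).toIntLinearMap).finrank_eq, h3, hrank] at h1
    exact finite_of_finrank_eq_zero (M := LinearMap.ker (g n).toIntLinearMap) (by omega)
  refine ⟨G, inferInstance, hfree, inferInstance, L, hL, hidx, hGr, ?_, ?_⟩
  · obtain ⟨e⟩ := nonempty_lim1_equiv_towerLim1 f hf hs hcof
    obtain ⟨e'⟩ := nonempty_towerLim1_equiv (A := fun n => A (s n)) (B := fun n => L n)
      (fun n => f (hs n.le_succ)) (inclTower hL) (fun n => (g n).rangeRestrict)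
      (fun n x => Subtype.ext (hg n x)) (fun n => (g n).rangeRestrict_surjective) hker
    exact ⟨e.trans e'⟩
  · intro p hp n m x _
    obtain ⟨a, rfl⟩ := hmk x
    obtain ⟨k, hk⟩ := hp (hs (Nat.zero_le m)) (Multiplicative.ofAdd (a : A (s 0) ⧸ _))
    refine ⟨k, ?_⟩
    have hk' : ((p ^ k • a : A (s 0)) : A (s 0) ⧸ (f (hs (Nat.zero_le m))).range) = 0 := hk
    obtain ⟨b, hb⟩ := (QuotientAddGroup.eq_zero_iff _).1 hk'
    refine ⟨b, ?_⟩
    change mk (f _ b) = _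
    rw [hb, map_nsmul]

end Reduction

/-! ### The decomposition of `lim¹` -/

theorem mainTheorem9 {I : Type v} [Preorder I] [IsDirectedOrder I] [Countable I]
    {A : I → Type u} [∀ i, AddCommGroup (A i)]
    (f : ∀ ⦃i j : I⦄, i ≤ j → A j →+ A i)
    (hf : InverseSystem (fun i j (h : i ≤ j) => (f h : A j → A i)))
    (hfg : ∀ i, AddGroup.FG (A i))
    (r : ℕ) (hrank : ∀ i, Module.finrank ℤ (A i) = r)
    (hcoker : ∀ ⦃i j : I⦄ (h : i ≤ j), Finite (A i ⧸ (f h).range)) :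
    (Nontrivial (Lim1 f) →
      (∃ n : Nat.Primes → Cardinal.{0}, HasJensenDecomposition (Lim1 f) n) ∧
      ∀ n : Nat.Primes → Cardinal.{0}, HasJensenDecomposition (Lim1 f) n → ∀ q, n q ≤ r) ∧
    ∀ p : Nat.Primes,
      (∀ ⦃i j : I⦄ (h : i ≤ j), IsPGroup (p : ℕ) (Multiplicative (A i ⧸ (f h).range))) →
      Subsingleton (Lim1 f) ∨
        ((∃ n : Nat.Primes → Cardinal.{0}, HasJensenDecomposition (Lim1 f) n) ∧
        ∀ n : Nat.Primes → Cardinal.{0}, HasJensenDecomposition (Lim1 f) n →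
          (∀ l, l ≠ p → n p < n l) ∧ ∀ l l', l ≠ p → l' ≠ p → n l = n l') := by
  rcases subsingleton_or_nontrivial (Lim1 f) with hsub | hnt
  · exact ⟨fun h => absurd hsub (not_subsingleton_iff_nontrivial.2 h), fun _ _ => Or.inl hsub⟩
  have hI : Nonempty I := by
    by_contra hI
    rw [not_nonempty_iff] at hI
    have : Subsingleton (roosD1 f).ker :=
      ⟨fun a b => Subtype.ext (funext fun x => (hI.false x.1.1).elim)⟩
    have : Subsingleton (Lim1 f) := QuotientAddGroup.mk_surjective.subsingleton
    exact not_subsingleton (Lim1 f) this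
  obtain ⟨G, _, _, _, L, hL, _, hGr, ⟨e⟩, hpL⟩ := exists_subgroup_tower f hf hfg r hrank hcoker
  have hnt' : Nontrivial (InclLim1 hL) := e.symm.toEquiv.nontrivial
  obtain ⟨k, s, hk⟩ := exists_torsion_exponents hL
  have hexists : ∃ n : Nat.Primes → Cardinal.{0}, HasJensenDecomposition (Lim1 f) n :=
    ⟨_, (hasJensenDecomposition_of_card (towerLim1_divisible hL)
      (mk_towerLim1 hL (exists_not_le_succ hL hnt')) k fun q => (hk q).1).congr e.symm⟩
  have hunique : ∀ n, HasJensenDecomposition (Lim1 f) n → ∀ q, n q = (k q : ℕ) := by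
    intro n hn q
    have hfin : Finite (nTorsion (InclLim1 hL) q) :=
      Nat.finite_of_card_ne_zero (by rw [(hk q).1]; exact pow_ne_zero _ q.2.ne_zero)
    obtain ⟨k', hk', hcard⟩ := (hn.congr e).exponent_eq q hfin
    rw [hk', Nat.pow_right_injective q.2.two_le (hcard.symm.trans (hk q).1)]
  refine ⟨fun _ => ⟨hexists, fun n hn q => ?_⟩, fun p hp => Or.inr ⟨hexists, fun n hn => ?_⟩⟩
  · rw [hunique n hn q, Nat.cast_le]
    have := (hk q).2.2
    omega
  · have hne : ∀ l, l ≠ p → k l + s = r := fun l hl => by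
      have h1 := limModCard_eq_of_ne hL p.2 l.2 (fun h => hl (Nat.Primes.coe_nat_injective h))
        (hpL p hp)
      rw [← (hk l).2.1, hGr] at h1
      exact Nat.pow_right_injective l.2.two_le h1
    have hlt : k p + s < r := by
      refine lt_of_le_of_ne ((hk p).2.2.trans_eq hGr) fun h => ?_
      obtain ⟨N, hN⟩ := exists_stable_of_limModCard_eq hL p.2 (hpL p hp) (by
        rw [← (hk p).2.1, h, hGr])
      exact not_subsingleton (InclLim1 hL) (subsingleton_towerLim1_of_stable hL N hN)
    refine ⟨fun l hl => ?_, fun l l' hl hl' => ?_⟩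
    · rw [hunique n hn, hunique n hn, Nat.cast_lt]
      have := hne l hl
      omega
    · rw [hunique n hn, hunique n hn, Nat.cast_inj]
      have := hne l hl
      have := hne l' hl'
      omega
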